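/- Let $K$ be a field. A Novikov algebra over $K$ is a (not necessarily associative or unital, possibly infinite-dimensional) $K$-algebra $N$ satisfying $(x,y,z)=(y,x,z)$ and $(xy)z=(xz)y$ for all $x,y,z\in N$, where $(x,y,z)=(xy)z-x(yz)$. For a $K$-algebra $A$ put $A^{(0)}=A$ and $A^{(m)}=A^{(m-1)}A^{(m-1)}$ (the linear span of all products of two elements of $A^{(m-1)}$) for $m\ge 1$; the algebra $A$ is called solvable if $A^{(m)}=0$ for some positive integer $m$. Theorem. Let $N$ be a Novikov algebra over $K$ and let $G$ be a finite solvable group of ($K$-linear) automorphisms of $N$. If the subalgebra of invariants $N^G=\{x\in N \mid \phi(x)=x \text{ for all } \phi\in G\}$ is solvable and the characteristic of $K$ does not divide the order of $G$ (a condition that holds automatically in characteristic $0$), then $N$ is solvable. -/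

import Mathlib

/-- The defining identities of a Novikov algebra: left symmetry `(x, y, z) = (y, x, z)` of the
associator `(x, y, z) = (x * y) * z - x * (y * z)`, and right commutativity. -/
structure IsNovikov (N : Type*) [NonUnitalNonAssocRing N] : Prop where
  left_symm : ∀ x y z : N, associator x y z = associator y x z
  right_comm : ∀ x y z : N, (x * y) * z = (x * z) * y

section Algebra

variable (K A : Type*) [Field K] [NonUnitalNonAssocRing A] [Module K A]
  [IsScalarTower K A A] [SMulCommClass K A A]

/-- The derived powers of a (not necessarily associative or unital) algebra `A`:
`A^(0) = A` and `A^(m+1) = A^(m) A^(m)`, the linear span of all products of two elements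
of `A^(m)`. -/
def derivedPower : ℕ → Submodule K A
  | 0 => ⊤
  | m + 1 => Submodule.map₂ (LinearMap.mul K A) (derivedPower m) (derivedPower m)

/-- The algebra `A` is solvable if `A^(m) = 0` for some positive integer `m`. -/
def IsSolvableAlgebra : Prop :=
  ∃ m : ℕ, 0 < m ∧ derivedPower K A m = ⊥

/-- The group of algebra automorphisms of `A`: the multiplicative `K`-linear bijections, under
composition. -/
def algebraAut : Subgroup (A ≃ₗ[K] A) where
  carrier := {φ | ∀ x y : A, φ (x * y) = φ x * φ y}
  mul_mem' := by
    intro φ ψ hφ hψ x y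
    rw [LinearEquiv.mul_apply, LinearEquiv.mul_apply, LinearEquiv.mul_apply, hψ, hφ]
  one_mem' := by
    intro x y
    rfl
  inv_mem' := by
    intro φ hφ x y
    change φ.symm (x * y) = φ.symm x * φ.symm y
    rw [LinearEquiv.symm_apply_eq, hφ, LinearEquiv.apply_symm_apply, LinearEquiv.apply_symm_apply]

variable {K A}

/-- The subalgebra of invariants `A^G` of a group `G` of automorphisms of `A`. -/
def invariantSubalgebra (G : Subgroup (algebraAut K A)) : NonUnitalSubalgebra K A where
  carrier := {x | ∀ φ ∈ G, (φ : A ≃ₗ[K] A) x = x}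
  add_mem' := by
    intro x y hx hy φ hφ
    rw [map_add, hx φ hφ, hy φ hφ]
  zero_mem' := by
    intro φ _
    exact map_zero _
  mul_mem' := by
    intro x y hx hy φ hφ
    rw [φ.2 x y, hx φ hφ, hy φ hφ]
  smul_mem' := by
    intro c x hx φ hφ
    rw [map_smul, hx φ hφ]

end Algebra

/-! The right multiplications `R_y` of a Novikov algebra `N` commute, so they generate a commutative
algebra `R`. Left symmetry says that `D_x = [L_x, ·]` is a derivation of `R`, and writing `ρ y` for
`R_y` as an element of `R` one has, for `F ∈ R` and `x ∈ N`,
`ρ(F x) = F ρ(x) + D_x F` and `D_{F x} = F D_x`.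

From these identities `ρ(x) ρ(y) ρ(z)` lies in the ideal of `R` generated by `ρ(T)` as soon as `T`
contains `xy`, `xz` and `(xy)z`. Descending along the derived series, a solvable algebra mapping to
`N` generates a nilpotent ideal of `R`; conversely `N` is solvable once `R` is generated by a
nilpotent ideal (`IsSolvableAlgebra.actsRightNilpotently_range`,
`ActsRightNilpotently.isSolvableAlgebra`). The theorem thus becomes a statement about `R`.

For a cyclic group `⟨σ⟩` of order `n = k + 1` extend the scalars so that `N` is the sum of the
eigenspaces of `σ`, and let `J` be the nilpotent ideal generated by `ρ` of the invariants. If `x` and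
the factors of `F` come from one eigenspace and `F` has `k` or `2 k + 1` factors, then `F x` is
invariant, so `F ρ(x) + D_x F ∈ J`. Comparing the two lengths removes `ρ(x)` and shows that, modulo
`J` and after multiplication by enough factors, all logarithmic derivatives `D_x u / u` agree and
`n` times their common value vanishes. As `n` is invertible, the derivatives vanish, hence so do
long products (`mul_mem_of_mul_add_derivation_mem`). So `R` is generated by a finite sum of
nilpotent ideals.

A finite solvable group reduces to the cyclic case: a nontrivial one is generated by a proper normal
subgroup `M` and one element `τ`, and `τ` acts on the invariants of `M`. -/

open scoped Pointwise TensorProduct IsMulCommutative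

/-! ### Right nilpotency and the right multiplication algebra -/

section Pow

variable {K A : Type*} [Field K] [NonUnitalNonAssocRing A] [Module K A] [IsScalarTower K A A]

variable (K) in
/-- A set `S` acts right nilpotently on the algebra `A` if for some `m` all products
`(…((x * y₁) * y₂) * …) * yₘ` with `x ∈ A` and `y₁, …, yₘ ∈ S` vanish; it is phrased with the
pointwise powers of the set of right multiplications by elements of `S`. -/
def ActsRightNilpotently (S : Set A) : Prop :=
  ∃ m : ℕ, (LinearMap.mulRight K '' S) ^ m ⊆ {0}

end Pow

/-- A presentation of the algebra generated by the right multiplications of a Novikov algebra `N`: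
a commutative ring `R` acting faithfully on `N` through `toEnd`, elements `rho y` acting as right
multiplication by `y`, and derivations `der x` of `R` (the commutators with left multiplication
by `x`). In the model `x * y = x y'` of a differential commutative ring, `rho y` is `y'` and
`der x` is `x d/dt`. -/
structure RightMulModel (K N R : Type*) [Field K] [NonUnitalNonAssocRing N] [Module K N]
    [IsScalarTower K N N] [SMulCommClass K N N] [CommRing R] [Algebra K R] where
  toEnd : R →ₐ[K] Module.End K N
  injective : Function.Injective toEnd
  rho : N →ₗ[K] R
  toEnd_rho : ∀ y, toEnd (rho y) = LinearMap.mulRight K y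
  der : N → Derivation K R R
  der_toEnd : ∀ f x g, der (toEnd f x) g = f * der x g
  rho_toEnd : ∀ f x, rho (toEnd f x) = f * rho x + der x f

section Model

variable {K N : Type*} [Field K] [NonUnitalNonAssocRing N] [Module K N]
  [IsScalarTower K N N] [SMulCommClass K N N]

/-- Left symmetry as an operator identity: `[L_x, R_z] = R_{xz} - R_x R_z`. -/
theorem IsNovikov.mulLeft_commutator_mulRight (hN : IsNovikov N) (x z : N) :
    LinearMap.mulLeft K x * LinearMap.mulRight K z - LinearMap.mulRight K z * LinearMap.mulLeft K x
      = LinearMap.mulRight K (x * z) - LinearMap.mulRight K x * LinearMap.mulRight K z := by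
  ext y
  have h := hN.left_symm x y z
  have h' := hN.right_comm y z x
  simp only [associator] at h
  simp only [LinearMap.sub_apply, Module.End.mul_apply, LinearMap.mulLeft_apply,
    LinearMap.mulRight_apply, h', sub_eq_sub_iff_add_eq_add] at h ⊢
  rw [add_comm (y * (x * z)), h, add_comm]

/-- The right multiplication algebra of a Novikov algebra is commutative, because right
multiplications commute, and it is stable under commutators with left multiplications. -/
theorem IsNovikov.exists_rightMulModel.{u, v} {K : Type u} {N : Type v} [Field K]
    [NonUnitalNonAssocRing N] [Module K N] [IsScalarTower K N N] [SMulCommClass K N N] (hN : IsNovikov N) :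
    ∃ (R : Type v) (_ : CommRing R) (_ : Algebra K R), Nonempty (RightMulModel K N R) := by
  let S : Subalgebra K (Module.End K N) := Algebra.adjoin K (Set.range (LinearMap.mulRight K))
  have : IsMulCommutative S := by
    refine Algebra.isMulCommutative_adjoin K ?_
    rintro _ ⟨y, rfl⟩ _ ⟨z, rfl⟩
    ext x
    exact hN.right_comm x z y
  have hcomm : ∀ f ∈ S, ∀ g ∈ S, f * g = g * f := fun f hf g hg =>
    congrArg Subtype.val (mul_comm (⟨f, hf⟩ : S) ⟨g, hg⟩)
  have hR : ∀ y, LinearMap.mulRight K y ∈ S := fun y => Algebra.subset_adjoin ⟨y, rfl⟩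
  let L : N →ₗ[K] Module.End K N := LinearMap.mul K N
  -- The commutator with a left multiplication preserves `S`.
  have hstab : ∀ x, ∀ f ∈ S, L x * f - f * L x ∈ S := by
    intro x f hf
    induction hf using Algebra.adjoin_induction with
    | mem f hf =>
      obtain ⟨z, rfl⟩ := hf
      have := hN.mulLeft_commutator_mulRight (K := K) x z
      change LinearMap.mulLeft K x * _ - _ * LinearMap.mulLeft K x ∈ S
      rw [this]
      exact S.sub_mem (hR _) (S.mul_mem (hR _) (hR _))
    | algebraMap r =>
      rw [← Algebra.commutes, sub_self]
      exact S.zero_mem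
    | add f g _ _ hf hg =>
      convert S.add_mem hf hg using 1
      noncomm_ring
    | mul f g hf' hg' hf hg =>
      convert S.add_mem (S.mul_mem hf hg') (S.mul_mem hf' hg) using 1
      noncomm_ring
  have hleft : ∀ f ∈ S, ∀ x, L (f x) = f * L x := by
    intro f hf
    induction hf using Algebra.adjoin_induction with
    | mem f hf =>
      obtain ⟨z, rfl⟩ := hf
      intro x
      ext y
      exact hN.right_comm x z y
    | algebraMap r =>
      intro x
      rw [Module.algebraMap_end_apply, map_smul, Algebra.smul_def]
    | add f g _ _ hf hg =>
      intro x
      rw [LinearMap.add_apply, map_add, hf, hg, add_mul]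
    | mul f g _ _ hf hg =>
      intro x
      rw [Module.End.mul_apply, hf, hg, mul_assoc]
  have hrho : ∀ f ∈ S, ∀ x, LinearMap.mulRight K (f x)
      = f * LinearMap.mulRight K x + (L x * f - f * L x) := by
    intro f hf
    induction hf using Algebra.adjoin_induction with
    | mem f hf =>
      obtain ⟨z, rfl⟩ := hf
      intro x
      have := hN.mulLeft_commutator_mulRight (K := K) x z
      change _ = _ + (LinearMap.mulLeft K x * _ - _ * LinearMap.mulLeft K x)
      rw [this, hcomm _ (hR z) _ (hR x), add_sub_cancel]
      rfl
    | algebraMap r =>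
      intro x
      rw [← Algebra.commutes, sub_self, add_zero, Module.algebraMap_end_apply, ← Algebra.smul_def]
      ext y
      exact mul_smul_comm r y x
    | add f g _ _ hf hg =>
      intro x
      have : LinearMap.mulRight K (f x + g x)
          = LinearMap.mulRight K (f x) + LinearMap.mulRight K (g x) := by
        ext y
        simp [mul_add]
      rw [LinearMap.add_apply, this, hf, hg]
      noncomm_ring
    | mul f g hf' hg' hf hg =>
      intro x
      have h1 := hcomm _ (hstab x f hf') _ hg'
      have h2 : L x * (f * g) = f * (L x * g) + g * (L x * f) - f * (g * L x) := by
        rw [sub_mul, mul_sub, ← mul_assoc g f, ← hcomm f hf' g hg', sub_eq_sub_iff_add_eq_add] at h1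
        rw [eq_sub_iff_add_eq, ← mul_assoc, ← mul_assoc f g, h1]
        noncomm_ring
      rw [Module.End.mul_apply, hf, hg, hleft g hg', h2]
      noncomm_ring
  let δ : N → Derivation K S S := fun x => Derivation.mk'
    { toFun := fun f => ⟨L x * f - f * L x, hstab x f f.2⟩
      map_add' := fun f g => Subtype.ext <| by
        simp only [Subalgebra.coe_add]
        noncomm_ring
      map_smul' := fun r f => Subtype.ext <| by
        simp [smul_sub] }
    (fun f g => Subtype.ext <| by
      have h1 := hcomm _ (hstab x f f.2) _ g.2
      simp only [LinearMap.coe_mk, AddHom.coe_mk, smul_eq_mul, Subalgebra.coe_mul,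
        Subalgebra.coe_add]
      rw [← h1]
      noncomm_ring)
  refine ⟨S, inferInstance, inferInstance, ⟨⟨S.val, Subtype.val_injective,
    { toFun := fun y => ⟨LinearMap.mulRight K y, hR y⟩
      map_add' := fun x y => Subtype.ext <| by
        ext z
        simp [mul_add]
      map_smul' := fun r x => Subtype.ext <| by
        ext z
        exact mul_smul_comm r z x }, fun y => rfl, δ, ?_, ?_⟩⟩⟩
  · intro f x g
    apply Subtype.ext
    change L (f.1 x) * g.1 - g.1 * L (f.1 x) = f.1 * (L x * g.1 - g.1 * L x)
    rw [hleft f f.2, ← mul_assoc, ← hcomm f f.2 g g.2]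
    noncomm_ring
  · intro f x
    exact Subtype.ext (hrho f f.2 x)

variable {R : Type*} [CommRing R] [Algebra K R]

namespace RightMulModel

theorem actsRightNilpotently_iff (M : RightMulModel K N R) (S : Set N) :
    ActsRightNilpotently K S ↔ IsNilpotent (Ideal.span (M.rho '' S)) := by
  refine exists_congr fun m => ?_
  have h1 : LinearMap.mulRight K '' S = M.toEnd '' (M.rho '' S) := by
    rw [Set.image_image]
    exact Set.image_congr fun y _ => (M.toEnd_rho y).symm
  have h2 : Ideal.span (M.rho '' S) ^ m = Ideal.span ((M.rho '' S) ^ m) :=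
    Submodule.span_pow _ _
  rw [h1, h2, ← Set.image_pow, Ideal.zero_eq_bot, Ideal.span_eq_bot]
  simp only [Set.subset_singleton_iff, Set.forall_mem_image]
  exact forall₂_congr fun f _ => map_eq_zero_iff _ M.injective

theorem rho_mul_rho_mul_rho (M : RightMulModel K N R) (x y z : N) :
    M.rho x * M.rho y * M.rho z
      = M.rho (x * y) * M.rho z + M.rho y * M.rho (x * z) - M.rho (x * y * z) := by
  have h : ∀ a b : N, a * b = M.toEnd (M.rho b) a := fun a b => by rw [M.toEnd_rho]; rfl
  rw [h (x * y) z, M.rho_toEnd, h x z, M.rho_toEnd, h x y, M.der_toEnd]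
  ring

end RightMulModel

/-! ### Solvability and right nilpotency -/

/-- Right nilpotency is inherited upwards along a step of the derived series: the cube of the ideal
of `S` lies in the ideal of `T`. -/
theorem ActsRightNilpotently.of_mul_mem (hN : IsNovikov N) {S T : Set N}
    (hSS : ∀ x ∈ S, ∀ y ∈ S, x * y ∈ T) (hTS : ∀ x ∈ T, ∀ y ∈ S, x * y ∈ T)
    (hT : ActsRightNilpotently K T) : ActsRightNilpotently K S := by
  obtain ⟨R, _, _, ⟨M⟩⟩ := hN.exists_rightMulModel (K := K)
  rw [M.actsRightNilpotently_iff] at hT ⊢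
  have hle : Ideal.span (M.rho '' S) ^ 3 ≤ Ideal.span (M.rho '' T) := by
    have h2 : Ideal.span (M.rho '' S) ^ 3 = Ideal.span ((M.rho '' S) ^ 3) :=
      Submodule.span_pow _ _
    rw [h2, Ideal.span_le]
    intro f hf
    rw [pow_succ, pow_two] at hf
    obtain ⟨_, ⟨_, ⟨x, hx, rfl⟩, _, ⟨y, hy, rfl⟩, rfl⟩, _, ⟨z, hz, rfl⟩, rfl⟩ := hf
    have hmem : ∀ t ∈ T, M.rho t ∈ Ideal.span (M.rho '' T) := fun t ht =>
      Ideal.subset_span ⟨t, ht, rfl⟩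
    change M.rho x * M.rho y * M.rho z ∈ _
    rw [M.rho_mul_rho_mul_rho]
    exact sub_mem (add_mem (Ideal.mul_mem_right _ _ (hmem _ (hSS x hx y hy)))
      (Ideal.mul_mem_left _ _ (hmem _ (hSS x hx z hz)))) (hmem _ (hTS _ (hSS x hx y hy) z hz))
  obtain ⟨m, hm⟩ := hT
  refine ⟨3 * m, ?_⟩
  rw [pow_mul, ← le_zero_iff, ← hm]
  exact Ideal.pow_right_mono hle m

theorem derivedPower_succ_le (m : ℕ) : derivedPower K N (m + 1) ≤ derivedPower K N m := by
  induction m with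
  | zero => exact le_top
  | succ m ih => exact Submodule.map₂_le_map₂ ih ih

/-- A solvable subalgebra acts right nilpotently on the whole of `N`, not only on itself. -/
theorem IsSolvableAlgebra.actsRightNilpotently_range (hN : IsNovikov N) {B : Type*}
    [NonUnitalNonAssocRing B] [Module K B] [IsScalarTower K B B] [SMulCommClass K B B]
    (hB : IsSolvableAlgebra K B) (f : B →ₙₐ[K] N) : ActsRightNilpotently K (Set.range f) := by
  obtain ⟨m, -, hm⟩ := hB
  have key : ∀ j, ActsRightNilpotently K (f '' (derivedPower K B j : Set B)) →
      ActsRightNilpotently K (Set.range f) := by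
    intro j
    induction j with
    | zero =>
      intro h
      simpa [derivedPower] using h
    | succ j ih =>
      refine fun h => ih (h.of_mul_mem hN ?_ ?_)
      · rintro _ ⟨x, hx, rfl⟩ _ ⟨y, hy, rfl⟩
        exact ⟨x * y, Submodule.apply_mem_map₂ _ hx hy, map_mul f x y⟩
      · rintro _ ⟨x, hx, rfl⟩ _ ⟨y, hy, rfl⟩
        exact ⟨x * y, Submodule.apply_mem_map₂ _ (derivedPower_succ_le j hx) hy, map_mul f x y⟩
  refine key m ⟨1, ?_⟩
  rw [hm]
  rw [pow_one]
  rintro _ ⟨_, ⟨_, rfl, rfl⟩, rfl⟩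
  ext y
  simp

/-- The `m`-th derived power consists of sums of left-normed products of length `m + 1`. -/
theorem ActsRightNilpotently.isSolvableAlgebra (h : ActsRightNilpotently K (Set.univ : Set N)) :
    IsSolvableAlgebra K N := by
  have key : ∀ (m : ℕ) (W : Submodule K N),
      (∀ T ∈ (LinearMap.mulRight K '' (Set.univ : Set N)) ^ m, ∀ x, T x ∈ W) →
      derivedPower K N m ≤ W := by
    intro m
    induction m with
    | zero => exact fun W hW x _ => hW 1 (by simp) x
    | succ m ih =>
      intro W hW
      refine Submodule.map₂_le.2 fun a ha b _ => ?_
      refine ih (W.comap (LinearMap.mulRight K b)) (fun T hT x => ?_) ha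
      refine hW (LinearMap.mulRight K b * T) ?_ x
      rw [pow_succ']
      exact Set.mul_mem_mul ⟨b, trivial, rfl⟩ hT
  obtain ⟨m, hm⟩ := h
  refine ⟨m + 1, m.succ_pos, ?_⟩
  rw [eq_bot_iff]
  refine (derivedPower_succ_le m).trans (key m ⊥ fun T hT x => ?_)
  rw [hm hT]
  exact Submodule.zero_mem _

end Model

/-! ### Algebras graded by the eigenspaces of an automorphism -/

section Graded

theorem mul_derivation_mem_of_mem_pow {K R : Type*} [CommRing K] [CommRing R] [Algebra K R]
    {J : Ideal R} {U : Set R} (D : Derivation K R R) {Q : R} (hQ : ∀ w ∈ U, Q * D w ∈ J) (m : ℕ) :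
    ∀ F ∈ U ^ m, Q * D F ∈ J := by
  induction m with
  | zero =>
    intro F hF
    rw [pow_zero, Set.mem_one] at hF
    simp [hF]
  | succ m ih =>
    intro F hF
    rw [pow_succ] at hF
    obtain ⟨G, hG, u, hu, rfl⟩ := hF
    have : Q * D (G * u) = G * (Q * D u) + u * (Q * D G) := by
      rw [D.leibniz, smul_eq_mul, smul_eq_mul]
      ring
    change Q * D (G * u) ∈ J
    rw [this]
    exact add_mem (J.mul_mem_left _ (hQ u hu)) (J.mul_mem_left _ (ih G hG))

/-- If the logarithmic derivatives of elements of `U` agree, up to the factor `P` and modulo `J`,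
then that of a product of `m` of them is `m` times that of one. -/
theorem mul_derivation_sub_natCast_mul_mem {K R : Type*} [CommRing K] [CommRing R] [Algebra K R]
    {J : Ideal R} {U : Set R} (D : Derivation K R R) {P : R}
    (hP : ∀ u ∈ U, ∀ w ∈ U, P * (w * D u - u * D w) ∈ J) (m : ℕ) :
    ∀ G ∈ U ^ m, ∀ w ∈ U, P * (w * D G - m * (G * D w)) ∈ J := by
  induction m with
  | zero =>
    intro F hF
    rw [pow_zero, Set.mem_one] at hF
    simp [hF]
  | succ m ih =>
    intro F hF w hw
    rw [pow_succ] at hF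
    obtain ⟨G, hG, u, hu, rfl⟩ := hF
    have : P * (w * D (G * u) - (m + 1 : ℕ) * (G * u * D w))
        = u * (P * (w * D G - m * (G * D w))) + G * (P * (w * D u - u * D w)) := by
      rw [D.leibniz, smul_eq_mul, smul_eq_mul]
      push_cast
      ring
    change P * (w * D (G * u) - (m + 1 : ℕ) * (G * u * D w)) ∈ J
    rw [this]
    exact add_mem (J.mul_mem_left _ (ih G hG w hw)) (J.mul_mem_left _ (hP u hu w hw))

/-- The algebraic heart of the graded case. The hypotheses in the two lengths `k` and `2 k + 1`
first eliminate `v`; then all `w * D u - u * D w` die after multiplication by `2 k` elements of `U`,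
and invertibility of `k + 1` makes the derivatives `D w` themselves die. -/
theorem mul_mem_of_mul_add_derivation_mem {K R : Type*} [CommRing K] [CommRing R] [Algebra K R]
    {J : Ideal R} {U : Set R} (D : Derivation K R R) (v : R) (k : ℕ)
    (hk : IsUnit ((k + 1 : ℕ) : R))
    (h1 : ∀ F ∈ U ^ k, F * v + D F ∈ J) (h2 : ∀ F ∈ U ^ (2 * k + 1), F * v + D F ∈ J) :
    ∀ F ∈ U ^ (4 * k + 1), F * v ∈ J := by
  -- Comparing the hypothesis for `F * G` with that for `F` removes `v`.
  have hFG : ∀ F ∈ U ^ k, ∀ G ∈ U ^ (k + 1), F * D G ∈ J := by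
    intro F hF G hG
    have hmem : F * G ∈ U ^ (2 * k + 1) := by
      rw [two_mul, add_assoc, pow_add]
      exact Set.mul_mem_mul hF hG
    have : F * D G = (F * G * v + D (F * G)) - G * (F * v + D F) := by
      rw [D.leibniz, smul_eq_mul, smul_eq_mul]
      ring
    rw [this]
    exact sub_mem (h2 _ hmem) (J.mul_mem_left _ (h1 F hF))
  have hP : ∀ F ∈ U ^ k, ∀ G ∈ U ^ k, ∀ u ∈ U, ∀ w ∈ U,
      F * G * (w * D u - u * D w) ∈ J := by
    intro F hF G hG u hu w hw
    have : F * G * (w * D u - u * D w) = w * (F * D (G * u)) - u * (F * D (G * w)) := by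
      simp only [D.leibniz, smul_eq_mul]
      ring
    rw [this]
    refine sub_mem (J.mul_mem_left _ (hFG F hF _ ?_)) (J.mul_mem_left _ (hFG F hF _ ?_))
    · rw [pow_succ]
      exact Set.mul_mem_mul hG hu
    · rw [pow_succ]
      exact Set.mul_mem_mul hG hw
  have hQ : ∀ F ∈ U ^ k, ∀ F' ∈ U ^ k, ∀ G ∈ U ^ (k + 1), ∀ w ∈ U, F * F' * G * D w ∈ J := by
    intro F hF F' hF' G hG w hw
    have h := mul_derivation_sub_natCast_mul_mem D (hP F hF F' hF') (k + 1) G hG w hw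
    have : ((k + 1 : ℕ) : R) * (F * F' * G * D w)
        = F' * w * (F * D G) - F * F' * (w * D G - (k + 1 : ℕ) * (G * D w)) := by ring
    rw [← J.unit_mul_mem_iff_mem hk, this]
    exact sub_mem (J.mul_mem_left _ (hFG F hF G hG)) h
  intro F hF
  rw [show 4 * k + 1 = k + k + (k + 1) + k by ring, pow_add, pow_add, pow_add] at hF
  obtain ⟨_, ⟨_, ⟨F₁, hF₁, F₂, hF₂, rfl⟩, G, hG, rfl⟩, H, hH, rfl⟩ := hF
  have : F₁ * F₂ * G * H * v = F₁ * F₂ * G * (H * v + D H) - F₁ * F₂ * G * D H := by ring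
  change F₁ * F₂ * G * H * v ∈ J
  rw [this]
  exact sub_mem (J.mul_mem_left _ (h1 H hH))
    (mul_derivation_mem_of_mem_pow D (hQ F₁ hF₁ F₂ hF₂ G hG) k H hH)

variable {K N : Type*} [Field K] [NonUnitalNonAssocRing N] [Module K N]
  [IsScalarTower K N N] [SMulCommClass K N N]

theorem RightMulModel.toEnd_mem_eigenspace {R : Type*} [CommRing R] [Algebra K R]
    (M : RightMulModel K N R) {σ : Module.End K N} (hσ : ∀ x y, σ (x * y) = σ x * σ y) {χ : K}
    (m : ℕ) : ∀ F ∈ (M.rho '' (σ.eigenspace χ : Set N)) ^ m, ∀ x ∈ σ.eigenspace χ,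
      M.toEnd F x ∈ σ.eigenspace (χ ^ (m + 1)) := by
  induction m with
  | zero =>
    intro F hF x hx
    rw [pow_zero, Set.mem_one] at hF
    simpa [hF] using hx
  | succ m ih =>
    intro F hF x hx
    rw [pow_succ'] at hF
    obtain ⟨_, ⟨y, hy, rfl⟩, G, hG, rfl⟩ := hF
    change M.toEnd (M.rho y * G) x ∈ _
    have h := ih G hG x hx
    rw [SetLike.mem_coe, Module.End.mem_eigenspace_iff] at hy
    rw [Module.End.mem_eigenspace_iff] at h ⊢
    rw [map_mul, Module.End.mul_apply, M.toEnd_rho, LinearMap.mulRight_apply, hσ, hy, h,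
      smul_mul_smul_comm, ← pow_succ]

/-- The graded case: the eigenspaces of `σ` grade `N` by the group of roots of unity, with the
invariants as the component of degree zero. -/
theorem ActsRightNilpotently.univ_of_eigenspaces (hN : IsNovikov N) (σ : Module.End K N)
    (hσ : ∀ x y, σ (x * y) = σ x * σ y) (k : ℕ) (hk : ((k + 1 : ℕ) : K) ≠ 0) (I : Finset K)
    (hI : ∀ χ ∈ I, χ ^ (k + 1) = 1) (hspan : ⨆ χ ∈ I, σ.eigenspace χ = ⊤)
    (h : ActsRightNilpotently K {x | σ x = x}) :
    ActsRightNilpotently K (Set.univ : Set N) := by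
  obtain ⟨R, _, _, ⟨M⟩⟩ := hN.exists_rightMulModel (K := K)
  rw [M.actsRightNilpotently_iff] at h ⊢
  set J : Ideal R := Ideal.span (M.rho '' {x | σ x = x}) with hJ
  have hunit : IsUnit ((k + 1 : ℕ) : R) := by
    have := (IsUnit.mk0 _ hk).map (algebraMap K R)
    rwa [map_natCast] at this
  have hχ : ∀ χ ∈ I, IsNilpotent (Ideal.span (M.rho '' (σ.eigenspace χ : Set N))) := by
    intro χ hχ
    set U : Set R := M.rho '' (σ.eigenspace χ : Set N) with hU
    -- The weight of `F x` is `χ ^ (m + 1)`, so `F x` is invariant when this power is `1`.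
    have hinv : ∀ m, χ ^ (m + 1) = 1 → ∀ x ∈ σ.eigenspace χ, ∀ F ∈ U ^ m,
        F * M.rho x + M.der x F ∈ J := by
      intro m hm x hx F hF
      have hmem := M.toEnd_mem_eigenspace hσ m F hF x hx
      rw [hm, Module.End.mem_eigenspace_iff, one_smul] at hmem
      rw [← M.rho_toEnd]
      exact Ideal.subset_span ⟨_, hmem, rfl⟩
    have hle : Ideal.span U ^ (4 * k + 1 + 1) ≤ J := by
      have h2 : Ideal.span U ^ (4 * k + 1 + 1) = Ideal.span (U ^ (4 * k + 1 + 1)) :=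
        Submodule.span_pow _ _
      rw [h2, Ideal.span_le, pow_succ]
      rintro _ ⟨F, hF, _, ⟨x, hx, rfl⟩, rfl⟩
      refine mul_mem_of_mul_add_derivation_mem (M.der x) (M.rho x) k hunit
        (hinv k (hI χ hχ) x hx) (hinv (2 * k + 1) ?_ x hx) F hF
      rw [show 2 * k + 1 + 1 = (k + 1) * 2 by ring, pow_mul, hI χ hχ, one_pow]
    obtain ⟨m, hm⟩ := h
    refine ⟨(4 * k + 1 + 1) * m, ?_⟩
    rw [pow_mul, ← le_zero_iff, ← hm]
    exact Ideal.pow_right_mono hle m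
  obtain ⟨m, hm⟩ := isNilpotent_sum hχ
  refine ⟨m, ?_⟩
  rw [← le_zero_iff, ← hm]
  refine Ideal.pow_right_mono (Ideal.span_le.2 ?_) m
  have hle : (⊤ : Submodule K N) ≤ Submodule.comap M.rho
      ((∑ χ ∈ I, Ideal.span (M.rho '' (σ.eigenspace χ : Set N))).restrictScalars K) := by
    rw [← hspan]
    refine iSup₂_le fun χ hχ x hx => ?_
    have h1 : M.rho x ∈ Ideal.span (M.rho '' (σ.eigenspace χ : Set N)) :=
      Ideal.subset_span ⟨x, hx, rfl⟩
    have h2 : Ideal.span (M.rho '' (σ.eigenspace χ : Set N))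
        ≤ ∑ χ ∈ I, Ideal.span (M.rho '' (σ.eigenspace χ : Set N)) := by
      rw [Ideal.sum_eq_sup]
      exact Finset.le_sup (f := fun χ => Ideal.span (M.rho '' (σ.eigenspace χ : Set N))) hχ
    exact h2 h1
  rintro _ ⟨x, -, rfl⟩
  exact hle (Submodule.mem_top (x := x))

/-- An endomorphism of finite order invertible in `K` is diagonalisable if `K` has enough roots of
unity. -/
theorem Module.End.iSup_eigenspace_eq_top_of_pow_eq_one {K V : Type*} [Field K] [AddCommGroup V]
    [Module K V] (σ : Module.End K V) {n : ℕ} (hn : (n : K) ≠ 0) (hσ : σ ^ n = 1) {ζ : K}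
    (hζ : IsPrimitiveRoot ζ n) :
    ⨆ χ ∈ Polynomial.nthRootsFinset n (1 : K), σ.eigenspace χ = ⊤ := by
  have hn0 : 0 < n := Nat.pos_of_ne_zero fun h => hn (by simp [h])
  have hζ0 : ζ ≠ 0 := hζ.ne_zero hn0.ne'
  rw [eq_top_iff]
  rintro x -
  -- `p i` is `n` times the projection of `x` to the eigenspace of `ζ ^ i`.
  let a : ℕ → ℕ → V := fun i j => (ζ⁻¹ ^ i) ^ j • (σ ^ j) x
  let p : ℕ → V := fun i => ∑ j ∈ Finset.range n, a i j
  have hp : ∀ i, p i ∈ σ.eigenspace (ζ ^ i) := by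
    intro i
    have h1 : ∀ j, σ (a i j) = ζ ^ i • a i (j + 1) := by
      intro j
      have : ζ ^ i * ζ⁻¹ ^ i = 1 := by rw [← mul_pow, mul_inv_cancel₀ hζ0, one_pow]
      simp only [a]
      rw [map_smul, pow_succ' σ, Module.End.mul_apply, smul_smul, pow_succ' (ζ⁻¹ ^ i), ← mul_assoc,
        this, one_mul]
    have h2 : a i n = a i 0 := by
      simp only [a]
      rw [hσ, ← pow_mul, mul_comm, pow_mul, inv_pow, hζ.pow_eq_one]
      simp
    rw [Module.End.mem_eigenspace_iff]
    simp only [p]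
    rw [map_sum, Finset.sum_congr rfl fun j _ => h1 j, ← Finset.smul_sum]
    congr 1
    have h3 := Finset.sum_range_succ (a i) n
    rw [Finset.sum_range_succ', h2] at h3
    exact add_right_cancel h3
  have hsum : ∑ i ∈ Finset.range n, p i = (n : K) • x := by
    simp only [p, a]
    rw [Finset.sum_comm, Finset.sum_eq_single_of_mem 0 (Finset.mem_range.2 hn0)]
    · simp [Nat.cast_smul_eq_nsmul]
    · intro j hj hj0
      have h1 : ζ⁻¹ ^ j ≠ 1 := hζ.inv.pow_ne_one_of_pos_of_lt hj0 (Finset.mem_range.1 hj)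
      have h2 : ∑ i ∈ Finset.range n, (ζ⁻¹ ^ j) ^ i = 0 := by
        rw [geom_sum_eq h1, ← pow_mul, mul_comm, pow_mul, hζ.inv.pow_eq_one]
        simp
      simp_rw [← pow_mul, mul_comm _ j, pow_mul]
      rw [← Finset.sum_smul, h2, zero_smul]
  have hx : x = (n : K)⁻¹ • ∑ i ∈ Finset.range n, p i := by
    rw [hsum, inv_smul_smul₀ hn]
  rw [hx]
  refine Submodule.smul_mem _ _ (Submodule.sum_mem _ fun i _ => ?_)
  refine Submodule.mem_iSup_of_mem (ζ ^ i) (Submodule.mem_iSup_of_mem ?_ (hp i))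
  rw [Polynomial.mem_nthRootsFinset hn0, ← pow_mul, mul_comm, pow_mul, hζ.pow_eq_one, one_pow]

end Graded

/-! ### Extension of scalars -/

section BaseChange

variable {K N : Type*} [Field K] [NonUnitalNonAssocRing N] [Module K N]
  [IsScalarTower K N N] [SMulCommClass K N N]

theorem IsNovikov.baseChange (hN : IsNovikov N) (L : Type*) [Field L] [Algebra K L] :
    IsNovikov (L ⊗[K] N) where
  left_symm x y z := by
    simp only [associator]
    induction x with
    | zero => simp
    | add x₁ x₂ h₁ h₂ =>
      simp only [add_mul, mul_add, add_sub_add_comm, h₁, h₂]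
    | tmul a x =>
      induction y with
      | zero => simp
      | add y₁ y₂ h₁ h₂ =>
        simp only [add_mul, mul_add, add_sub_add_comm, h₁, h₂]
      | tmul b y =>
        induction z with
        | zero => simp
        | add z₁ z₂ h₁ h₂ =>
          simp only [mul_add, add_sub_add_comm, h₁, h₂]
        | tmul c z =>
          have h := hN.left_symm x y z
          simp only [associator] at h
          simp only [Algebra.TensorProduct.tmul_mul_tmul, mul_assoc, mul_left_comm b a c,
            ← TensorProduct.tmul_sub, h]
  right_comm x y z := by
    induction x with
    | zero => simp
    | add x₁ x₂ h₁ h₂ => simp only [add_mul, h₁, h₂]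
    | tmul a x =>
      induction y with
      | zero => simp
      | add y₁ y₂ h₁ h₂ => simp only [add_mul, mul_add, h₁, h₂]
      | tmul b y =>
        induction z with
        | zero => simp
        | add z₁ z₂ h₁ h₂ => simp only [add_mul, mul_add, h₁, h₂]
        | tmul c z =>
          simp only [Algebra.TensorProduct.tmul_mul_tmul, hN.right_comm x y z, mul_right_comm]

theorem LinearMap.baseChange_mulRight (L : Type*) [Field L] [Algebra K L] (y : N) :
    (LinearMap.mulRight K y).baseChange L = LinearMap.mulRight L ((1 : L) ⊗ₜ[K] y) := by
  ext x
  simp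

theorem image_mulRight_one_tmul (L : Type*) [Field L] [Algebra K L] (S : Set N) :
    LinearMap.mulRight L '' ((fun y => (1 : L) ⊗ₜ[K] y) '' S)
      = Module.End.baseChangeHom K L N '' (LinearMap.mulRight K '' S) := by
  rw [Set.image_image, Set.image_image]
  exact Set.image_congr fun y _ => (LinearMap.baseChange_mulRight L y).symm

/-- Right nilpotency is a multilinear condition, so it passes to spans over an extension field. -/
theorem ActsRightNilpotently.span_one_tmul (L : Type*) [Field L] [Algebra K L] {S : Set N}
    (h : ActsRightNilpotently K S) :
    ActsRightNilpotently L
      (Submodule.span L ((fun y => (1 : L) ⊗ₜ[K] y) '' S) : Set (L ⊗[K] N)) := by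
  obtain ⟨m, hm⟩ := h
  refine ⟨m, fun T hT => ?_⟩
  let ρ : (L ⊗[K] N) →ₗ[L] Module.End L (L ⊗[K] N) := (LinearMap.mul L (L ⊗[K] N)).flip
  have hle : LinearMap.mulRight L ''
      (Submodule.span L ((fun y => (1 : L) ⊗ₜ[K] y) '' S) : Set (L ⊗[K] N))
      ⊆ (Submodule.span L (LinearMap.mulRight L '' ((fun y => (1 : L) ⊗ₜ[K] y) '' S)) :
        Set (Module.End L (L ⊗[K] N))) := by
    rintro _ ⟨y, hy, rfl⟩
    have hy' := Submodule.mem_map_of_mem (f := ρ) hy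
    rwa [Submodule.map_span] at hy'
  have hT' := Submodule.pow_subset_pow _ (Set.pow_subset_pow_left hle hT)
  rw [SetLike.mem_coe, Submodule.span_pow, image_mulRight_one_tmul, ← Set.image_pow] at hT'
  refine (Submodule.span_le (p := ⊥)).2 ?_ hT'
  rintro _ ⟨f, hf, rfl⟩
  rw [hm hf, map_zero]
  exact Submodule.zero_mem _

theorem ActsRightNilpotently.of_baseChange_univ (L : Type*) [Field L] [Algebra K L]
    (h : ActsRightNilpotently L (Set.univ : Set (L ⊗[K] N))) :
    ActsRightNilpotently K (Set.univ : Set N) := by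
  obtain ⟨m, hm⟩ := h
  refine ⟨m, fun T hT => ?_⟩
  have hT' : Module.End.baseChangeHom K L N T
      ∈ (LinearMap.mulRight L '' (Set.univ : Set (L ⊗[K] N))) ^ m := by
    refine Set.pow_subset_pow_left
      (Set.image_mono (Set.subset_univ ((fun y => (1 : L) ⊗ₜ[K] y) '' Set.univ))) ?_
    rw [image_mulRight_one_tmul, ← Set.image_pow]
    exact ⟨T, hT, rfl⟩
  have hinj : Function.Injective (Module.End.baseChangeHom K L N) :=
    LinearMap.baseChangeHom_injective _ _ _
  exact hinj ((hm hT').trans (map_zero _).symm)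

/-- The case of a cyclic group: the invariants of `σ` on the scalar extension are spanned by the
invariants on `N` since the latter are the image of the averaging operator. -/
theorem ActsRightNilpotently.univ_of_fixedPoints (hN : IsNovikov N) (σ : Module.End K N)
    (hσ : ∀ x y, σ (x * y) = σ x * σ y) {n : ℕ} (hn : (n : K) ≠ 0) (hσn : σ ^ n = 1)
    (h : ActsRightNilpotently K {x | σ x = x}) : ActsRightNilpotently K (Set.univ : Set N) := by
  let L := AlgebraicClosure K
  have hnL : (n : L) ≠ 0 := by
    rw [← map_natCast (algebraMap K L)]
    exact (map_ne_zero _).2 hn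
  have : NeZero (n : L) := ⟨hnL⟩
  obtain ⟨ζ, hζ⟩ := HasEnoughRootsOfUnity.exists_primitiveRoot L n
  let τ : Module.End L (L ⊗[K] N) := Module.End.baseChangeHom K L N σ
  have hττ : ∀ j (c : L) x, (τ ^ j) (c ⊗ₜ[K] x) = c ⊗ₜ[K] (σ ^ j) x := by
    intro j c x
    simp only [τ, ← map_pow]
    rfl
  have hτ1 : ∀ (c : L) x, τ (c ⊗ₜ[K] x) = c ⊗ₜ[K] σ x := fun _ _ => rfl
  have hτ : ∀ x y, τ (x * y) = τ x * τ y := by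
    intro x y
    induction x with
    | zero => simp
    | add x₁ x₂ h₁ h₂ => simp only [add_mul, map_add, h₁, h₂]
    | tmul a x =>
      induction y with
      | zero => simp
      | add y₁ y₂ h₁ h₂ => simp only [mul_add, map_add, h₁, h₂]
      | tmul b y => simp only [Algebra.TensorProduct.tmul_mul_tmul, hτ1, hσ]
  have hτn : τ ^ n = 1 := by rw [← map_pow, hσn, map_one]
  have hfix : {x | τ x = x}
      ⊆ (Submodule.span L ((fun y => (1 : L) ⊗ₜ[K] y) '' {x | σ x = x}) : Set (L ⊗[K] N)) := by
    have htrace : ∀ x, ∑ j ∈ Finset.range n, (τ ^ j) x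
        ∈ Submodule.span L ((fun y => (1 : L) ⊗ₜ[K] y) '' {x | σ x = x}) := by
      intro x
      induction x with
      | zero => simp
      | add x y hx hy =>
        simp only [map_add, Finset.sum_add_distrib]
        exact add_mem hx hy
      | tmul c x =>
        have : ∑ j ∈ Finset.range n, (τ ^ j) (c ⊗ₜ[K] x)
            = c • ((1 : L) ⊗ₜ[K] ∑ j ∈ Finset.range n, (σ ^ j) x) := by
          simp only [hττ]
          rw [TensorProduct.smul_tmul', smul_eq_mul, mul_one, TensorProduct.tmul_sum]
        rw [this]
        refine Submodule.smul_mem _ _ (Submodule.subset_span ⟨_, ?_, rfl⟩)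
        have h3 := Finset.sum_range_succ (fun j => (σ ^ j) x) n
        rw [Finset.sum_range_succ', hσn, pow_zero] at h3
        change σ _ = _
        rw [map_sum, ← add_right_cancel h3]
        simp only [pow_succ', Module.End.mul_apply]
    intro x hx
    have hx' : ∀ j, (τ ^ j) x = x := by
      intro j
      induction j with
      | zero => rfl
      | succ j ih => rw [pow_succ, Module.End.mul_apply, hx, ih]
    have h1 := htrace x
    simp only [hx', Finset.sum_const, Finset.card_range, ← Nat.cast_smul_eq_nsmul L] at h1
    exact (Submodule.smul_mem_iff _ hnL).1 h1
  have hn0 : 0 < n := Nat.pos_of_ne_zero fun h => hn (by simp [h])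
  obtain ⟨k, rfl⟩ : ∃ k, n = k + 1 := ⟨n - 1, by omega⟩
  refine ActsRightNilpotently.of_baseChange_univ L ?_
  refine ActsRightNilpotently.univ_of_eigenspaces (hN.baseChange L) τ hτ k hnL _
    (fun χ hχ => (Polynomial.mem_nthRootsFinset hn0 1).1 hχ)
    (τ.iSup_eigenspace_eq_top_of_pow_eq_one hnL hτn hζ) ?_
  obtain ⟨m, hm⟩ := h.span_one_tmul L
  exact ⟨m, (Set.pow_subset_pow_left (Set.image_mono hfix)).trans hm⟩

end BaseChange

/-! ### Finite solvable groups -/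

section Group

/-- A maximal subgroup containing the commutator subgroup is normal, and any element outside it
generates the group together with it. -/
theorem Group.IsSolvable.exists_normal_sup_zpowers_eq_top (G : Type*) [Group G] [Finite G]
    [Group.IsSolvable G] [Nontrivial G] :
    ∃ (M : Subgroup G) (g : G), M.Normal ∧ M ≠ ⊤ ∧ M ⊔ Subgroup.zpowers g = ⊤ := by
  obtain h | ⟨M, hM, hle⟩ := eq_top_or_exists_le_coatom (commutator G)
  · exact absurd h (Group.IsSolvable.commutator_lt_top_of_nontrivial G).ne
  · obtain ⟨g, -, hg⟩ := SetLike.exists_of_lt hM.lt_top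
    refine ⟨M, g, Subgroup.Normal.of_commutator_le G hle, hM.1, hM.2 _ ?_⟩
    refine lt_of_le_of_ne le_sup_left fun h => hg ?_
    rw [h]
    exact Subgroup.mem_sup_right (Subgroup.mem_zpowers g)

theorem mem_invariantSubalgebra_iff_le_stabilizer {K N : Type*} [Field K]
    [NonUnitalNonAssocRing N] [Module K N] (H : Subgroup (algebraAut K N)) (x : N) :
    x ∈ invariantSubalgebra H ↔ H ≤ MulAction.stabilizer (algebraAut K N) x :=
  Iff.rfl

variable {K N : Type*} [Field K] [NonUnitalNonAssocRing N] [Module K N]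
  [IsScalarTower K N N] [SMulCommClass K N N]

/-- One step of the composition series: passage from the invariants of `H = ⟨M, τ⟩` to those of a
normal subgroup `M`, on which `τ` acts with the former as invariants. -/
theorem isSolvableAlgebra_invariantSubalgebra_of_sup_zpowers (hN : IsNovikov N)
    {H M : Subgroup (algebraAut K N)} {τ : algebraAut K N}
    (hH : M ⊔ Subgroup.zpowers τ = H) (hτM : ∀ φ ∈ M, τ⁻¹ * φ * τ ∈ M) {n : ℕ}
    (hn : (n : K) ≠ 0) (hτn : τ ^ n = 1)
    (h : IsSolvableAlgebra K (invariantSubalgebra H)) :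
    IsSolvableAlgebra K (invariantSubalgebra M) := by
  have hle : M ≤ H := hH ▸ le_sup_left
  have hτH : τ ∈ H := hH ▸ Subgroup.mem_sup_right (Subgroup.mem_zpowers τ)
  have hA : IsNovikov (invariantSubalgebra M) :=
    ⟨fun x y z => Subtype.ext (hN.left_symm x y z), fun x y z => Subtype.ext (hN.right_comm x y z)⟩
  have hstable : ∀ x ∈ invariantSubalgebra M, τ • x ∈ invariantSubalgebra M := by
    intro x hx φ hφ
    change φ • τ • x = τ • x
    have h1 : (τ⁻¹ * φ * τ) • x = x := hx _ (hτM φ hφ)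
    rwa [mul_smul, mul_smul, inv_smul_eq_iff] at h1
  let σ : Module.End K (invariantSubalgebra M) :=
    { toFun := fun x => ⟨τ • (x : N), hstable x x.2⟩
      map_add' := fun x y => Subtype.ext (smul_add τ (x : N) y)
      map_smul' := fun r x => Subtype.ext (map_smul τ.1 r (x : N)) }
  have hσ : ∀ j x, (((σ ^ j) x : invariantSubalgebra M) : N) = τ ^ j • (x : N) := by
    intro j
    induction j with
    | zero => intro x; simp
    | succ j ih =>
      intro x
      rw [pow_succ, pow_succ, Module.End.mul_apply, ih, mul_smul]
      rfl
  refine (ActsRightNilpotently.univ_of_fixedPoints hA σ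
    (fun x y => Subtype.ext (τ.2 x y)) hn ?_ ?_).isSolvableAlgebra
  · ext x
    rw [hσ, hτn, one_smul]
    rfl
  · have hincl : invariantSubalgebra H ≤ invariantSubalgebra M := fun x hx φ hφ => hx φ (hle hφ)
    convert h.actsRightNilpotently_range hA (NonUnitalSubalgebra.inclusion hincl) using 1
    ext x
    constructor
    · intro hx
      refine ⟨⟨x, (mem_invariantSubalgebra_iff_le_stabilizer H _).2 (hH ▸ sup_le x.2 ?_)⟩, rfl⟩
      rw [Subgroup.zpowers_le]
      exact congrArg Subtype.val hx
    · rintro ⟨y, rfl⟩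
      exact Subtype.ext (y.2 τ hτH)

theorem IsSolvableAlgebra.of_invariantSubalgebra_bot (hN : IsNovikov N)
    (h : IsSolvableAlgebra K (invariantSubalgebra (⊥ : Subgroup (algebraAut K N)))) :
    IsSolvableAlgebra K N := by
  refine ActsRightNilpotently.isSolvableAlgebra ?_
  convert h.actsRightNilpotently_range hN (NonUnitalSubalgebraClass.subtype
    (invariantSubalgebra (⊥ : Subgroup (algebraAut K N)))) using 1
  refine (Set.eq_univ_of_forall fun x => ?_).symm
  exact ⟨⟨x, (mem_invariantSubalgebra_iff_le_stabilizer _ _).2 bot_le⟩, rfl⟩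

/-- Induction on the order `c` of a subgroup `H` of `G` with solvable invariants. The exponent used
for all automorphisms is the order of `G`. -/
theorem isSolvableAlgebra_of_invariantSubalgebra_of_le (hN : IsNovikov N)
    (G : Subgroup (algebraAut K N)) [Finite G] [Group.IsSolvable G] (hn : (Nat.card G : K) ≠ 0)
    (c : ℕ) : ∀ H ≤ G, Nat.card H = c → IsSolvableAlgebra K (invariantSubalgebra H) →
      IsSolvableAlgebra K N := by
  induction c using Nat.strong_induction_on with
  | _ c ih =>
    intro H hHG hc h
    have : Finite H := Finite.of_injective _ (Subgroup.inclusion_injective hHG)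
    have : Group.IsSolvable H :=
      Group.isSolvable_of_isSolvable_injective (f := Subgroup.inclusion hHG)
        (Subgroup.inclusion_injective hHG)
    rcases Subgroup.bot_or_nontrivial H with rfl | hnt
    · exact h.of_invariantSubalgebra_bot hN
    obtain ⟨M, g, hM, hMtop, hMg⟩ := Group.IsSolvable.exists_normal_sup_zpowers_eq_top H
    have hMH : M.map H.subtype ≤ H := Subgroup.map_subtype_le M
    refine ih _ ?_ (M.map H.subtype) (hMH.trans hHG) rfl ?_
    · rw [← hc, Subgroup.card_map_of_injective H.subtype_injective]
      exact lt_of_le_of_ne M.card_le_card_group fun h =>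
        hMtop (Subgroup.card_eq_iff_eq_top M |>.1 h)
    · refine isSolvableAlgebra_invariantSubalgebra_of_sup_zpowers hN (τ := (g : algebraAut K N))
        ?_ ?_ hn ?_ h
      · have h1 := congrArg (Subgroup.map H.subtype) hMg
        rw [Subgroup.map_sup, MonoidHom.map_zpowers, ← MonoidHom.range_eq_map,
          Subgroup.range_subtype] at h1
        exact h1
      · rintro _ ⟨φ, hφ, rfl⟩
        refine ⟨g⁻¹ * φ * g, ?_, rfl⟩
        simpa using hM.conj_mem φ hφ g⁻¹
      · have h1 := pow_card_eq_one' (x := (⟨g, hHG g.2⟩ : G))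
        exact congrArg Subtype.val h1

end Group

theorem theorem3 {K N : Type*} [Field K] [NonUnitalNonAssocRing N] [Module K N]
    [IsScalarTower K N N] [SMulCommClass K N N] (hN : IsNovikov N)
    (G : Subgroup (algebraAut K N)) [Finite G] [Group.IsSolvable G]
    (hchar : ¬ ringChar K ∣ Nat.card G)
    (hG : IsSolvableAlgebra K (invariantSubalgebra G)) :
    IsSolvableAlgebra K N :=
  isSolvableAlgebra_of_invariantSubalgebra_of_le hN G (fun h => hchar ((ringChar.spec K _).1 h))
    _ G le_rfl rfl hG
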